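/- All $C^*$-algebras are unital, and a $C^*$-algebra $\mathcal{A}$ is an $AW^*$-algebra if for every non-empty subset $\mathcal{F}\subseteq\mathcal{A}$ there is a projection $p\in\mathcal{A}$ with $\{a\in\mathcal{A}: ba=0 \text{ for all } b\in\mathcal{F}\}=p\mathcal{A}$. The self-adjoint part $\mathcal{A}^{sa}$ carries its usual order; $a<b$ means that $b-a$ is positive and invertible. An operator interval of $\mathcal{A}$ is $\mathcal{A}^{sa}$, or one of the sets $\{c\in\mathcal{A}^{sa}: c\ge a\}$, $\{c\in\mathcal{A}^{sa}: c\le a\}$, $\{c\in\mathcal{A}^{sa}: a<c\}$, $\{c\in\mathcal{A}^{sa}: c<a\}$ with $a\in\mathcal{A}^{sa}$, or one of the sets $\{c\in\mathcal{A}^{sa}: a\le c\le b\}$, $\{c\in\mathcal{A}^{sa}: a\le c<b\}$, $\{c\in\mathcal{A}^{sa}: a<c\le b\}$, $\{c\in\mathcal{A}^{sa}: a<c<b\}$ with $a,b\in\mathcal{A}^{sa}$, $a<b$. An order isomorphism between partially ordered sets is a bijection that preserves the order in both directions. For an $AW^*$-algebra $\mathcal{A}$, let $p_{\mathcal{A}}(1)$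 be the unique central projection of $\mathcal{A}$ such that $p_{\mathcal{A}}(1)\mathcal{A}$ is either $0$ or of type $\mathrm{I}_1$ (its unit is an abelian projection) and $p_{\mathcal{A}}(1)^{\perp}\mathcal{A}$ has no direct summand of type $\mathrm{I}_1$, where $p^{\perp}=1-p$. For a projection $p$ and a set $\mathcal{F}$, write $p\mathcal{F}=\{pa: a\in\mathcal{F}\}$. **Theorem.** Let $\mathcal{A}$ and $\mathcal{B}$ be $AW^*$-algebras, let $\mathcal{I}\subseteq\mathcal{A}$ and $\mathcal{J}\subseteq\mathcal{B}$ be operator intervals, and let $\Phi:\mathcal{I}\to\mathcal{J}$ be an order isomorphism. Then there exists a unique pair of order isomorphisms $$\Phi_1: p_{\mathcal{A}}(1)\mathcal{I}\to p_{\mathcal{B}}(1)\mathcal{J},\qquad \Phi_{-1}: p_{\mathcal{A}}(1)^{\perp}\mathcal{I}\to p_{\mathcal{B}}(1)^{\perp}\mathcal{J}$$ such that $$\Phi(a)=\Phi_1\big(p_{\mathcal{A}}(1)a\big)+\Phi_{-1}\big(p_{\mathcal{A}}(1)^{\perp}a\big),\qquad a\in\mathcal{I}.$$ -/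

import Mathlib

/-- A (unital) C⋆-algebra is an AW⋆-algebra if the right annihilator of every non-empty subset `F`
is the principal right ideal `p A` generated by some projection `p`. -/
class IsAWStarAlgebra (A : Type*) [CStarAlgebra A] : Prop where
  exists_annihilator : ∀ F : Set A, F.Nonempty →
    ∃ p : A, IsStarProjection p ∧ {a : A | ∀ b ∈ F, b * a = 0} = {x : A | ∃ a : A, x = p * a}

section Types

variable {A : Type*} [CStarAlgebra A]

/-- A central projection of `A`. -/
def IsCentralProjection (p : A) : Prop :=
  IsStarProjection p ∧ ∀ x : A, p * x = x * p

/-- Murray-von Neumann equivalence: `v v⋆ = p` and `v⋆ v = q` for some `v`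
(which is a partial isometry when `p` and `q` are projections). -/
def MurrayVonNeumannEquiv (p q : A) : Prop :=
  ∃ v : A, v * star v = p ∧ star v * v = q

variable [PartialOrder A]

/-- A projection `e` is abelian if every projection `f ≤ e` is central in the corner `e A e`. -/
def IsAbelianProjection (e : A) : Prop :=
  IsStarProjection e ∧
    ∀ f : A, IsStarProjection f → f ≤ e → ∀ x : A, f * (e * x * e) = (e * x * e) * f

/-- For a central projection `p` of `A`, the direct summand `p A` is non-zero and of type `I_n`:
there are `n` mutually orthogonal, mutually equivalent abelian projections whose supremum
in the projection lattice is `p`, the unit of `p A`. -/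
def IsTypeI (n : ℕ) (p : A) : Prop :=
  IsCentralProjection p ∧ p ≠ 0 ∧
    ∃ e : Fin n → A, (∀ i, IsAbelianProjection (e i)) ∧
      (∀ i j, i ≠ j → e i * e j = 0) ∧
      (∀ i j, MurrayVonNeumannEquiv (e i) (e j)) ∧
      ∀ g : A, IsStarProjection g → ((∀ i, e i ≤ g) ↔ p ≤ g)

/-- `p` is a central projection such that `p A` is zero or of type `I_n`, and such that
`(1 - p) A` has no direct summand of type `I_n`. -/
def IsTypeIPart (n : ℕ) (p : A) : Prop :=
  IsCentralProjection p ∧ (p = 0 ∨ IsTypeI n p) ∧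
    ∀ q : A, IsTypeI n q → ¬ q ≤ 1 - p

theorem isTypeI_one_iff {p : A} :
    IsTypeI 1 p ↔ IsCentralProjection p ∧ p ≠ 0 ∧ IsAbelianProjection p := by
  constructor
  · rintro ⟨hp, h0, e, he, -, -, hs⟩
    have h1 : e 0 ≤ p := by
      have := (hs p hp.1).2 le_rfl
      exact this 0
    have h2 : p ≤ e 0 := by
      refine (hs (e 0) (he 0).1).1 fun i => ?_
      rw [Subsingleton.elim i 0]
    have h3 : e 0 = p := le_antisymm h1 h2
    exact ⟨hp, h0, h3 ▸ he 0⟩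
  · rintro ⟨hp, h0, ha⟩
    refine ⟨hp, h0, fun _ => p, fun _ => ha, ?_, ?_, ?_⟩
    · intro i j hij
      exact absurd (Subsingleton.elim i j) hij
    · intro i j
      refine ⟨p, ?_, ?_⟩ <;> rw [hp.1.isSelfAdjoint.star_eq] <;> exact hp.1.isIdempotentElem
    · intro g _
      exact ⟨fun h => h 0, fun h _ => h⟩

variable [StarOrderedRing A]

theorem IsTypeIPart.eq_of_one {p q : A} (hp : IsTypeIPart 1 p) (hq : IsTypeIPart 1 q) :
    p = q := by
  have key : ∀ p q : A, IsTypeIPart 1 p → IsTypeIPart 1 q → p ≤ q := by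
    intro p q hp hq
    obtain ⟨⟨hpP, hpc⟩, hp2, -⟩ := hp
    obtain ⟨⟨hqP, hqc⟩, -, hq3⟩ := hq
    rw [hpP.le_iff_mul_eq_left hqP]
    by_contra hne
    have hpp : p * p = p := hpP.isIdempotentElem
    have hq1 : IsStarProjection (1 - q) := hqP.one_sub
    have hqq : (1 - q) * (1 - q) = 1 - q := hq1.isIdempotentElem
    have hrc : ∀ x : A, p * (1 - q) * x = x * (p * (1 - q)) := by
      intro x
      have h1 : (1 - q) * x = x * (1 - q) := by rw [sub_mul, mul_sub, hqc x, one_mul, mul_one]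
      rw [mul_assoc, h1, ← mul_assoc, hpc x, mul_assoc]
    have hr : IsStarProjection (p * (1 - q)) := by
      refine ⟨?_, ?_⟩
      · change p * (1 - q) * (p * (1 - q)) = p * (1 - q)
        rw [mul_assoc, ← mul_assoc (1 - q), ← hpc (1 - q), mul_assoc, hqq, ← mul_assoc, hpp]
      · change star (p * (1 - q)) = p * (1 - q)
        rw [star_mul, hpP.isSelfAdjoint.star_eq, hq1.isSelfAdjoint.star_eq, hpc]
    have hr0 : p * (1 - q) ≠ 0 := by
      intro h
      apply hne
      rw [mul_sub, mul_one, sub_eq_zero] at h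
      exact h.symm
    have hrp : p * (1 - q) ≤ p := by
      rw [hr.le_iff_mul_eq_left hpP, ← hpc, ← mul_assoc, hpp]
    have hrq : p * (1 - q) ≤ 1 - q := by
      rw [hr.le_iff_mul_eq_left hq1, mul_assoc, hqq]
    have hpa : IsAbelianProjection p := by
      rcases hp2 with h | h
      · exact absurd (by rw [h, zero_mul]) hr0
      · exact (isTypeI_one_iff.1 h).2.2
    refine hq3 _ (isTypeI_one_iff.2 ⟨⟨hr, hrc⟩, hr0, hr, ?_⟩) hrq
    intro f hf hfr x
    have h := hpa.2 f hf (hfr.trans hrp) (p * (1 - q) * x * (p * (1 - q)))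
    have e1 : p * (p * (1 - q) * x * (p * (1 - q))) * p = p * (1 - q) * x * (p * (1 - q)) := by
      rw [mul_assoc p _ p, mul_assoc _ _ p, ← hpc (p * (1 - q)), ← mul_assoc p p, hpp,
        ← mul_assoc p, ← mul_assoc p, ← mul_assoc p, hpp]
    rwa [e1] at h
  exact le_antisymm (key p q hp hq) (key q p hq hp)

theorem exists_isTypeIPart_one (A : Type*) [CStarAlgebra A] [PartialOrder A] [StarOrderedRing A]
    [IsAWStarAlgebra A] : ∃ p : A, IsTypeIPart 1 p := by
  have hz : IsCentralProjection (0 : A) :=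
    ⟨IsStarProjection.zero (R := A), fun x => by rw [zero_mul, mul_zero]⟩
  have hza : IsAbelianProjection (0 : A) :=
    ⟨hz.1, fun f _ _ x => by simp⟩
  set F : Set A := {e | IsCentralProjection e ∧ IsAbelianProjection e} with hF
  obtain ⟨q, hq, hann⟩ := IsAWStarAlgebra.exists_annihilator F ⟨0, hz, hza⟩
  have hqq : q * q = q := hq.isIdempotentElem
  have mem_iff : ∀ y : A, (∀ e ∈ F, e * y = 0) ↔ q * y = y := by
    intro y
    have h : (∀ e ∈ F, e * y = 0) ↔ ∃ a : A, y = q * a := by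
      have := Set.ext_iff.1 hann y
      exact this
    rw [h]
    constructor
    · rintro ⟨a, rfl⟩
      rw [← mul_assoc, hqq]
    · intro h
      exact ⟨y, h.symm⟩
  have hFq : ∀ e ∈ F, e * q = 0 := (mem_iff q).2 hqq
  have hleft : ∀ x : A, q * (x * q) = x * q := by
    intro x
    rw [← mem_iff]
    intro e he
    rw [← mul_assoc, he.1.2 x, mul_assoc, hFq e he, mul_zero]
  have hqc : ∀ x : A, q * x = x * q := by
    intro x
    have h := congrArg star (hleft (star x))
    simp only [star_mul, star_star, hq.isSelfAdjoint.star_eq] at h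
    rw [← h, mul_assoc, hleft x]
  have hp : IsStarProjection (1 - q) := hq.one_sub
  have hpc : ∀ x : A, (1 - q) * x = x * (1 - q) := by
    intro x
    rw [sub_mul, mul_sub, hqc x, one_mul, mul_one]
  have hpa : IsAbelianProjection (1 - q) := by
    refine ⟨hp, fun f hf hfp x => ?_⟩
    have hfp' : f * (1 - q) = f := (hf.le_iff_mul_eq_left hp).1 hfp
    have hff : f * f = f := hf.isIdempotentElem
    have hcomm : ∀ y : A, f * y = y * f := by
      intro y
      have h1 : q * (f * y - y * f) = f * y - y * f := by
        rw [← mem_iff]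
        intro e he
        have hee : e * e = e := he.1.1.isIdempotentElem
        have hef : IsStarProjection (e * f) := by
          refine ⟨?_, ?_⟩
          · change e * f * (e * f) = e * f
            rw [mul_assoc, ← mul_assoc f, ← he.1.2 f, mul_assoc, hff, ← mul_assoc, hee]
          · change star (e * f) = e * f
            rw [star_mul, hf.isSelfAdjoint.star_eq, he.1.1.isSelfAdjoint.star_eq, he.1.2]
        have hle : e * f ≤ e := by
          rw [hef.le_iff_mul_eq_left he.1.1, ← he.1.2, ← mul_assoc, hee]
        have h := he.2.2 (e * f) hef hle y
        have e1 : e * f * (e * y * e) = e * (f * y) := by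
          rw [← he.1.2 (e * y), ← mul_assoc e e, hee, mul_assoc e f, ← mul_assoc f e,
            ← he.1.2 f, mul_assoc e f, ← mul_assoc e e, hee]
        have e2 : e * y * e * (e * f) = e * (y * f) := by
          rw [← he.1.2 (e * y), ← mul_assoc e e, hee, mul_assoc e y, ← mul_assoc y e,
            ← he.1.2 y, mul_assoc e y, ← mul_assoc e e, hee]
        rw [mul_sub, ← e1, ← e2, h, sub_self]
      have hqf : q * f = 0 := by
        rw [mul_sub, mul_one, sub_eq_self] at hfp'
        rw [hqc, hfp']
      have h2 : q * (f * y - y * f) = 0 := by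
        rw [mul_sub, ← mul_assoc, hqf, zero_mul, ← mul_assoc, hqc y, mul_assoc, hqf, mul_zero,
          sub_zero]
      rw [h2] at h1
      exact sub_eq_zero.1 h1.symm
    exact hcomm _
  refine ⟨1 - q, ⟨hp, hpc⟩, ?_, ?_⟩
  · by_cases h : 1 - q = 0
    · exact Or.inl h
    · exact Or.inr (isTypeI_one_iff.2 ⟨⟨hp, hpc⟩, h, hpa⟩)
  · intro r hr hle
    obtain ⟨hrc, hr0, hra⟩ := isTypeI_one_iff.1 hr
    rw [sub_sub_cancel, hrc.1.le_iff_mul_eq_left hq, hFq r ⟨hrc, hra⟩] at hle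
    exact hr0 hle.symm

/-- The central projection `p_A(1)`: the unique central projection `p` such that `p A` is zero or
of type `I_1` and `(1 - p) A` has no direct summand of type `I_1`. -/
noncomputable def typeIOnePart (A : Type*) [CStarAlgebra A] [PartialOrder A] [StarOrderedRing A]
    [IsAWStarAlgebra A] : A :=
  (exists_isTypeIPart_one A).choose

theorem isTypeIPart_typeIOnePart (A : Type*) [CStarAlgebra A] [PartialOrder A] [StarOrderedRing A]
    [IsAWStarAlgebra A] : IsTypeIPart 1 (typeIOnePart A) :=
  (exists_isTypeIPart_one A).choose_spec

end Types

section Intervals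

variable {A : Type*} [CStarAlgebra A] [PartialOrder A]

/-- The relation `a < b` of C⋆-algebra theory: `b - a` is positive and invertible
(not the strict part of the partial order). -/
def StrictlyBelow (a b : A) : Prop :=
  0 ≤ b - a ∧ IsUnit (b - a)

/-- The operator intervals of a C⋆-algebra. -/
inductive IsOperatorInterval : Set A → Prop
  | all : IsOperatorInterval {c : A | IsSelfAdjoint c}
  | ici (a : A) (ha : IsSelfAdjoint a) :
      IsOperatorInterval {c : A | IsSelfAdjoint c ∧ a ≤ c}
  | iic (a : A) (ha : IsSelfAdjoint a) :
      IsOperatorInterval {c : A | IsSelfAdjoint c ∧ c ≤ a}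
  | ioi (a : A) (ha : IsSelfAdjoint a) :
      IsOperatorInterval {c : A | IsSelfAdjoint c ∧ StrictlyBelow a c}
  | iio (a : A) (ha : IsSelfAdjoint a) :
      IsOperatorInterval {c : A | IsSelfAdjoint c ∧ StrictlyBelow c a}
  | icc (a b : A) (ha : IsSelfAdjoint a) (hb : IsSelfAdjoint b) (hab : StrictlyBelow a b) :
      IsOperatorInterval {c : A | IsSelfAdjoint c ∧ a ≤ c ∧ c ≤ b}
  | ico (a b : A) (ha : IsSelfAdjoint a) (hb : IsSelfAdjoint b) (hab : StrictlyBelow a b) :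
      IsOperatorInterval {c : A | IsSelfAdjoint c ∧ a ≤ c ∧ StrictlyBelow c b}
  | ioc (a b : A) (ha : IsSelfAdjoint a) (hb : IsSelfAdjoint b) (hab : StrictlyBelow a b) :
      IsOperatorInterval {c : A | IsSelfAdjoint c ∧ StrictlyBelow a c ∧ c ≤ b}
  | ioo (a b : A) (ha : IsSelfAdjoint a) (hb : IsSelfAdjoint b) (hab : StrictlyBelow a b) :
      IsOperatorInterval {c : A | IsSelfAdjoint c ∧ StrictlyBelow a c ∧ StrictlyBelow c b}

end Intervals

/-- The set `p F = {p a : a ∈ F}`. -/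
def leftCut {A : Type*} [Mul A] (p : A) (F : Set A) : Set A :=
  {x : A | ∃ a ∈ F, x = p * a}

/-- The element `p a` of `p F`, for `a ∈ F`. -/
def leftCut.mk {A : Type*} [Mul A] (p : A) {F : Set A} (a : F) : leftCut p F :=
  ⟨p * (a : A), (a : A), a.2, rfl⟩

/-!
For a central projection `p`, an operator interval is the order product of its cuts by `p` and
`1 - p`, so the theorem says that `Φ` respects the two product decompositions given by the
type `I₁` summands of the two algebras.

The summand `p A` is commutative, hence a lattice: two elements above `l` have a supremum as soon
as one of them differs from `l` only in that summand (`IsAbelianProjection.exists_sup`). Outside the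
type `I₁` summand this fails. By a spectral argument in AW⋆-algebras, a positive `y` with
`(1 - p) y ≠ 0` dominates a positive multiple of a projection `e` that is not central
(`IsTypeIPart.exists_noncentral_smul_le`), and a small multiple of `e` and the same multiple of
`1 - e` have no supremum within a wide closed interval (`IsStarProjection.not_exists_sup`). Since
any two points of an operator interval lie in a wide closed subinterval, comparing suprema shows
that elements with equal second components have images with equal second components
(`OrderIso.one_sub_mul_apply_eq_of_le`).

Applied also to the inverse of `Φ`, this makes the second component of `Φ a` a monotone function of
that of `a`; the corresponding fact for first components then follows from the product structure
alone (`OrderIso.mul_apply_eq_of_le`). So `Φ` induces order isomorphisms of the cuts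
(`leftCut.exists_orderIso`), and these are unique because the two components of `Φ a` determine
their values.
-/

/-! ### Central projections and the order -/

section Central

variable {A : Type*} [CStarAlgebra A]

theorem IsCentralProjection.one_sub {p : A} (hp : IsCentralProjection p) :
    IsCentralProjection (1 - p) :=
  ⟨hp.1.one_sub, fun x => by rw [sub_mul, mul_sub, hp.2 x, one_mul, mul_one]⟩

theorem IsCentralProjection.mul_self {p : A} (hp : IsCentralProjection p) : p * p = p :=
  hp.1.isIdempotentElem

theorem IsCentralProjection.mul_one_sub {p : A} (hp : IsCentralProjection p) :
    p * (1 - p) = 0 := by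
  rw [mul_sub, mul_one, hp.mul_self, sub_self]

theorem IsCentralProjection.one_sub_mul {p : A} (hp : IsCentralProjection p) :
    (1 - p) * p = 0 := by
  rw [sub_mul, one_mul, hp.mul_self, sub_self]

/-- The element of `A = p A ⊕ (1 - p) A` with first component that of `a` and second component
that of `b`. -/
def glue (p a b : A) : A := p * a + (1 - p) * b

theorem glue_self (p a : A) : glue p a a = a := by
  rw [glue, ← add_mul, add_sub_cancel, one_mul]

theorem IsCentralProjection.mul_glue {p : A} (hp : IsCentralProjection p) (a b : A) :
    p * glue p a b = p * a := by
  rw [glue, mul_add, ← mul_assoc, ← mul_assoc, hp.mul_self, hp.mul_one_sub, zero_mul, add_zero]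

theorem IsCentralProjection.one_sub_mul_glue {p : A} (hp : IsCentralProjection p) (a b : A) :
    (1 - p) * glue p a b = (1 - p) * b := by
  rw [glue, mul_add, ← mul_assoc, ← mul_assoc, hp.one_sub.mul_self, hp.one_sub_mul, zero_mul,
    zero_add]

theorem IsCentralProjection.isSelfAdjoint_mul {p a : A} (hp : IsCentralProjection p)
    (ha : IsSelfAdjoint a) : IsSelfAdjoint (p * a) := by
  change star (p * a) = p * a
  rw [star_mul, ha.star_eq, hp.1.isSelfAdjoint.star_eq, hp.2]

theorem IsCentralProjection.isSelfAdjoint_glue {p a b : A} (hp : IsCentralProjection p)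
    (ha : IsSelfAdjoint a) (hb : IsSelfAdjoint b) : IsSelfAdjoint (glue p a b) :=
  (hp.isSelfAdjoint_mul ha).add (hp.one_sub.isSelfAdjoint_mul hb)

variable [PartialOrder A] [StarOrderedRing A]

theorem IsCentralProjection.mul_nonneg {p a : A} (hp : IsCentralProjection p) (h : 0 ≤ a) :
    0 ≤ p * a := by
  have h1 := hp.1.isSelfAdjoint.conjugate_nonneg h
  rwa [mul_assoc, ← hp.2, ← mul_assoc, hp.mul_self] at h1

theorem IsCentralProjection.mul_le_mul {p a b : A} (hp : IsCentralProjection p) (h : a ≤ b) :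
    p * a ≤ p * b := by
  rw [← sub_nonneg, ← mul_sub]
  exact hp.mul_nonneg (sub_nonneg.2 h)

theorem le_of_mul_le_mul_of_one_sub_mul_le {p a b : A}
    (h₁ : p * a ≤ p * b) (h₂ : (1 - p) * a ≤ (1 - p) * b) : a ≤ b := by
  rw [← glue_self p a, ← glue_self p b]
  exact add_le_add h₁ h₂

theorem IsCentralProjection.glue_le_glue {p a b c d : A} (hp : IsCentralProjection p)
    (h₁ : a ≤ c) (h₂ : b ≤ d) : glue p a b ≤ glue p c d :=
  add_le_add (hp.mul_le_mul h₁) (hp.one_sub.mul_le_mul h₂)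

end Central

/-! ### Operator intervals -/

section Rays

variable {A : Type*} [CStarAlgebra A]

theorem isSelfAdjoint_real_smul_one (r : ℝ) : IsSelfAdjoint (r • (1 : A)) :=
  IsSelfAdjoint.smul (IsSelfAdjoint.all r) (IsSelfAdjoint.one A)

variable [PartialOrder A]

/-- The three kinds of sets of self-adjoint elements cut out by a lower bound: no bound,
a closed one, or an open one. -/
def IsLowerRay (L : Set A) : Prop :=
  L = {c | IsSelfAdjoint c} ∨ ∃ a, IsSelfAdjoint a ∧
    (L = {c | IsSelfAdjoint c ∧ a ≤ c} ∨ L = {c | IsSelfAdjoint c ∧ StrictlyBelow a c})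

theorem IsLowerRay.isSelfAdjoint {L : Set A} (hL : IsLowerRay L) {c : A} (hc : c ∈ L) :
    IsSelfAdjoint c := by
  rcases hL with rfl | ⟨a, -, rfl | rfl⟩
  exacts [hc, hc.1, hc.1]

theorem strictlyBelow_neg_neg {a b : A} : StrictlyBelow (-a) (-b) ↔ StrictlyBelow b a := by
  simp only [StrictlyBelow, neg_sub_neg]

variable [StarOrderedRing A]

theorem strictlyBelow_iff {a b : A} : StrictlyBelow a b ↔ ∃ r : ℝ, 0 < r ∧ a + r • 1 ≤ b := by
  constructor
  · rintro ⟨h, hu⟩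
    rcases subsingleton_or_nontrivial A with hA | hA
    · exact ⟨1, one_pos, (Subsingleton.elim _ _).le⟩
    obtain ⟨r, hr, h1⟩ := (CFC.exists_pos_algebraMap_le_iff h.isSelfAdjoint).2
      fun x hx => (hu.isStrictlyPositive h).spectrum_pos hx
    rw [Algebra.algebraMap_eq_smul_one, le_sub_iff_add_le'] at h1
    exact ⟨r, hr, h1⟩
  · rintro ⟨r, hr, h⟩
    have h1 : algebraMap ℝ A r ≤ b - a := by
      rwa [Algebra.algebraMap_eq_smul_one, le_sub_iff_add_le']
    have h2 : IsStrictlyPositive (algebraMap ℝ A r) := isStrictlyPositive_algebraMap hr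
    exact ⟨h2.nonneg.trans h1, CStarAlgebra.isUnit_of_le _ h1⟩

theorem smul_one_le_smul_one {r s : ℝ} (h : r ≤ s) : r • (1 : A) ≤ s • 1 :=
  smul_le_smul_of_nonneg_right h zero_le_one

theorem isSelfAdjoint_of_le {a b : A} (ha : IsSelfAdjoint a) (h : a ≤ b) : IsSelfAdjoint b := by
  have := (sub_nonneg.2 h).isSelfAdjoint.add ha
  rwa [sub_add_cancel] at this

theorem IsLowerRay.mem_of_le {L : Set A} (hL : IsLowerRay L) {c d : A} (hc : c ∈ L)
    (h : c ≤ d) : d ∈ L := by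
  have hd := isSelfAdjoint_of_le (hL.isSelfAdjoint hc) h
  rcases hL with rfl | ⟨a, -, rfl | rfl⟩
  · exact hd
  · exact ⟨hd, hc.2.trans h⟩
  · obtain ⟨r, hr, h1⟩ := strictlyBelow_iff.1 hc.2
    exact ⟨hd, strictlyBelow_iff.2 ⟨r, hr, h1.trans h⟩⟩

theorem IsLowerRay.glue_mem {L : Set A} (hL : IsLowerRay L) {p : A} (hp : IsCentralProjection p)
    {c d : A} (hc : c ∈ L) (hd : d ∈ L) : glue p c d ∈ L := by
  have hs := hp.isSelfAdjoint_glue (hL.isSelfAdjoint hc) (hL.isSelfAdjoint hd)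
  rcases hL with rfl | ⟨a, -, rfl | rfl⟩
  · exact hs
  · refine ⟨hs, ?_⟩
    rw [← glue_self p a]
    exact hp.glue_le_glue hc.2 hd.2
  · obtain ⟨r, hr, h1⟩ := strictlyBelow_iff.1 hc.2
    obtain ⟨s, hs', h2⟩ := strictlyBelow_iff.1 hd.2
    refine ⟨hs, strictlyBelow_iff.2 ⟨min r s, lt_min hr hs', ?_⟩⟩
    rw [← glue_self p (a + _)]
    refine hp.glue_le_glue (le_trans ?_ h1) (le_trans ?_ h2)
    · exact add_le_add_right (smul_one_le_smul_one (min_le_left _ _)) _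
    · exact add_le_add_right (smul_one_le_smul_one (min_le_right _ _)) _

theorem IsLowerRay.exists_le_le {L : Set A} (hL : IsLowerRay L) {c d : A} (hc : c ∈ L)
    (hd : d ∈ L) : ∃ e ∈ L, e ≤ c ∧ e ≤ d := by
  rcases hL with rfl | ⟨a, ha, rfl | rfl⟩
  · have hc' : IsSelfAdjoint c := hc
    have hd' : IsSelfAdjoint d := hd
    have h1 := hc'.neg_algebraMap_norm_le_self
    have h2 := hd'.neg_algebraMap_norm_le_self
    rw [Algebra.algebraMap_eq_smul_one, ← neg_smul] at h1 h2
    refine ⟨(-max ‖c‖ ‖d‖) • 1, isSelfAdjoint_real_smul_one _, le_trans ?_ h1, le_trans ?_ h2⟩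
    · exact smul_one_le_smul_one (neg_le_neg (le_max_left _ _))
    · exact smul_one_le_smul_one (neg_le_neg (le_max_right _ _))
  · exact ⟨a, ⟨ha, le_rfl⟩, hc.2, hd.2⟩
  · obtain ⟨r, hr, h1⟩ := strictlyBelow_iff.1 hc.2
    obtain ⟨s, hs, h2⟩ := strictlyBelow_iff.1 hd.2
    refine ⟨a + min r s • 1, ⟨ha.add (isSelfAdjoint_real_smul_one _),
      strictlyBelow_iff.2 ⟨_, lt_min hr hs, le_rfl⟩⟩, le_trans ?_ h1, le_trans ?_ h2⟩
    · exact add_le_add_right (smul_one_le_smul_one (min_le_left _ _)) _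
    · exact add_le_add_right (smul_one_le_smul_one (min_le_right _ _)) _

/-- Every operator interval is an intersection of a lower and an upper ray; upper rays are
treated as the negatives of lower rays. -/
theorem IsOperatorInterval.exists_rays {I : Set A} (hI : IsOperatorInterval I) :
    ∃ L U : Set A, IsLowerRay L ∧ IsLowerRay (Neg.neg ⁻¹' U) ∧ I = L ∩ U := by
  have hneg : ∀ c : A, IsSelfAdjoint (-c) ↔ IsSelfAdjoint c :=
    fun c => ⟨fun h => by simpa using h.neg, fun h => h.neg⟩
  have hall : IsLowerRay {c : A | IsSelfAdjoint c} := Or.inl rfl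
  have hall' : IsLowerRay (Neg.neg ⁻¹' {c : A | IsSelfAdjoint c}) := by
    refine Or.inl ?_
    ext c
    simp [hneg]
  have hic : ∀ a : A, IsSelfAdjoint a → IsLowerRay {c : A | IsSelfAdjoint c ∧ a ≤ c} :=
    fun a ha => Or.inr ⟨a, ha, Or.inl rfl⟩
  have hio : ∀ a : A, IsSelfAdjoint a → IsLowerRay {c : A | IsSelfAdjoint c ∧ StrictlyBelow a c} :=
    fun a ha => Or.inr ⟨a, ha, Or.inr rfl⟩
  have hic' : ∀ a : A, IsSelfAdjoint a →
      IsLowerRay (Neg.neg ⁻¹' {c : A | IsSelfAdjoint c ∧ c ≤ a}) := by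
    refine fun a ha => Or.inr ⟨-a, ha.neg, Or.inl ?_⟩
    ext c
    simp [neg_le, hneg]
  have hio' : ∀ a : A, IsSelfAdjoint a →
      IsLowerRay (Neg.neg ⁻¹' {c : A | IsSelfAdjoint c ∧ StrictlyBelow c a}) := by
    refine fun a ha => Or.inr ⟨-a, ha.neg, Or.inr ?_⟩
    ext c
    have := strictlyBelow_neg_neg (a := a) (b := -c)
    rw [neg_neg] at this
    simp [this, hneg]
  rcases hI with _ | ⟨a, ha⟩ | ⟨a, ha⟩ | ⟨a, ha⟩ | ⟨a, ha⟩ | ⟨a, b, ha, hb, -⟩ | ⟨a, b, ha, hb, -⟩ |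
    ⟨a, b, ha, hb, -⟩ | ⟨a, b, ha, hb, -⟩
  · exact ⟨_, _, hall, hall', by simp⟩
  · exact ⟨_, _, hic a ha, hall', by ext; simp; tauto⟩
  · exact ⟨_, _, hall, hic' a ha, by ext; simp⟩
  · exact ⟨_, _, hio a ha, hall', by ext; simp; tauto⟩
  · exact ⟨_, _, hall, hio' a ha, by ext; simp⟩
  · exact ⟨_, _, hic a ha, hic' b hb, by ext; simp; tauto⟩
  · exact ⟨_, _, hic a ha, hio' b hb, by ext; simp; tauto⟩
  · exact ⟨_, _, hio a ha, hic' b hb, by ext; simp; tauto⟩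
  · exact ⟨_, _, hio a ha, hio' b hb, by ext; simp; tauto⟩

theorem IsOperatorInterval.isSelfAdjoint {I : Set A} (hI : IsOperatorInterval I) {c : A}
    (hc : c ∈ I) : IsSelfAdjoint c := by
  obtain ⟨L, U, hL, -, rfl⟩ := hI.exists_rays
  exact hL.isSelfAdjoint hc.1

theorem IsOperatorInterval.mem_of_le_of_le {I : Set A} (hI : IsOperatorInterval I) {a b c : A}
    (ha : a ∈ I) (hb : b ∈ I) (hac : a ≤ c) (hcb : c ≤ b) : c ∈ I := by
  obtain ⟨L, U, hL, hU, rfl⟩ := hI.exists_rays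
  refine ⟨hL.mem_of_le ha.1 hac, ?_⟩
  have := hU.mem_of_le (c := -b) (d := -c) (by simpa using hb.2) (neg_le_neg hcb)
  simpa using this

theorem IsOperatorInterval.glue_mem {I : Set A} (hI : IsOperatorInterval I) {p : A}
    (hp : IsCentralProjection p) {a b : A} (ha : a ∈ I) (hb : b ∈ I) : glue p a b ∈ I := by
  obtain ⟨L, U, hL, hU, rfl⟩ := hI.exists_rays
  refine ⟨hL.glue_mem hp ha.1 hb.1, ?_⟩
  have := hU.glue_mem hp (c := -a) (d := -b) (by simpa using ha.2) (by simpa using hb.2)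
  have h2 : -glue p (-a) (-b) = glue p a b := by simp only [glue, mul_neg, ← neg_add, neg_neg]
  rw [Set.mem_preimage, h2] at this
  exact this

theorem IsOperatorInterval.exists_le_le {I : Set A} (hI : IsOperatorInterval I) {a b : A}
    (ha : a ∈ I) (hb : b ∈ I) : ∃ c ∈ I, c ≤ a ∧ c ≤ b := by
  obtain ⟨L, U, hL, hU, rfl⟩ := hI.exists_rays
  obtain ⟨c, hc, hca, hcb⟩ := hL.exists_le_le ha.1 hb.1
  refine ⟨c, ⟨hc, ?_⟩, hca, hcb⟩
  have := hU.mem_of_le (c := -a) (d := -c) (by simpa using ha.2) (neg_le_neg hca)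
  simpa using this

theorem IsOperatorInterval.exists_ge_ge {I : Set A} (hI : IsOperatorInterval I) {a b : A}
    (ha : a ∈ I) (hb : b ∈ I) : ∃ c ∈ I, a ≤ c ∧ b ≤ c := by
  obtain ⟨L, U, hL, hU, rfl⟩ := hI.exists_rays
  obtain ⟨c, hc, hca, hcb⟩ := hU.exists_le_le (c := -a) (d := -b) (by simpa using ha.2)
    (by simpa using hb.2)
  have hac : a ≤ -c := le_neg.1 hca
  exact ⟨-c, ⟨hL.mem_of_le ha.1 hac, hc⟩, hac, le_neg.1 hcb⟩

theorem IsOperatorInterval.exists_gap {I : Set A} (hI : IsOperatorInterval I) :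
    ∃ u ∈ I, ∃ w ∈ I, ∃ r : ℝ, 0 < r ∧ u + r • 1 ≤ w := by
  have hz : (0 : A) ≤ 1 := zero_le_one
  have hs : ∀ a : A, IsSelfAdjoint a → ∀ r : ℝ, IsSelfAdjoint (a + r • 1) :=
    fun a ha r => ha.add (isSelfAdjoint_real_smul_one r)
  have hle : ∀ a : A, ∀ r : ℝ, 0 ≤ r → a ≤ a + r • 1 := fun a r hr =>
    le_add_of_nonneg_right (smul_nonneg hr hz)
  have hadd : ∀ a : A, ∀ r s : ℝ, a + r • 1 + s • 1 = a + (r + s) • 1 := fun a r s => by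
    rw [add_smul, add_assoc]
  have hlt : ∀ a : A, ∀ r s : ℝ, r < s → StrictlyBelow (a + r • 1) (a + s • 1) := by
    intro a r s h
    refine strictlyBelow_iff.2 ⟨s - r, sub_pos.2 h, ?_⟩
    rw [hadd, add_sub_cancel]
  have hlt₀ : ∀ a : A, ∀ s : ℝ, 0 < s → StrictlyBelow a (a + s • 1) := by
    intro a s h
    simpa using hlt a 0 s h
  have hlt₁ : ∀ a : A, ∀ s : ℝ, s < 0 → StrictlyBelow (a + s • 1) a := by
    intro a s h
    simpa using hlt a s 0 h
  -- the points at one and two thirds of a bounded interval have a gap between them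
  have hbdd : ∀ a b : A, IsSelfAdjoint a → StrictlyBelow a b →
      (∀ u : A, IsSelfAdjoint u → StrictlyBelow a u → StrictlyBelow u b → u ∈ I) →
      ∃ u ∈ I, ∃ w ∈ I, ∃ r : ℝ, 0 < r ∧ u + r • 1 ≤ w := by
    intro a b ha hab h
    obtain ⟨r, hr, hrb⟩ := strictlyBelow_iff.1 hab
    refine ⟨a + (r / 3) • 1, h _ (hs _ ha _) (hlt₀ _ _ (by positivity)) ?_,
      a + (r / 3 + r / 3) • 1, h _ (hs _ ha _) (hlt₀ _ _ (by positivity)) ?_, r / 3,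
      by positivity, ?_⟩
    · refine strictlyBelow_iff.2 ⟨r - r / 3, by linarith, ?_⟩
      rwa [hadd, add_sub_cancel]
    · refine strictlyBelow_iff.2 ⟨r - (r / 3 + r / 3), by linarith, ?_⟩
      rwa [hadd, add_sub_cancel]
    · rw [hadd]
  have hsb : ∀ a b : A, StrictlyBelow a b → a ≤ b := fun a b h => sub_nonneg.1 h.1
  have h0 : IsSelfAdjoint (0 : A) := IsSelfAdjoint.zero A
  rcases hI with _ | ⟨a, ha⟩ | ⟨a, ha⟩ | ⟨a, ha⟩ | ⟨a, ha⟩ | ⟨a, b, ha, hb, h⟩ | ⟨a, b, ha, hb, h⟩ |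
    ⟨a, b, ha, hb, h⟩ | ⟨a, b, ha, hb, h⟩
  · exact ⟨0, h0, 0 + (1 : ℝ) • 1, hs _ h0 _, 1, one_pos, le_rfl⟩
  · exact ⟨a, ⟨ha, le_rfl⟩, a + (1 : ℝ) • 1, ⟨hs _ ha _, hle _ _ zero_le_one⟩, 1, one_pos, le_rfl⟩
  · refine ⟨a + (-1 : ℝ) • 1, ⟨hs _ ha _, hsb _ _ (hlt₁ _ _ (by norm_num))⟩, a, ⟨ha, le_rfl⟩, 1,
      one_pos, ?_⟩
    rw [hadd]
    simp
  · refine ⟨a + (1 : ℝ) • 1, ⟨hs _ ha _, hlt₀ _ _ one_pos⟩, a + (1 + 1 : ℝ) • 1,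
      ⟨hs _ ha _, hlt₀ _ _ (by norm_num)⟩, 1, one_pos, ?_⟩
    rw [hadd]
  · refine ⟨a + (-2 : ℝ) • 1, ⟨hs _ ha _, hlt₁ _ _ (by norm_num)⟩, a + (-2 + 1 : ℝ) • 1,
      ⟨hs _ ha _, hlt₁ _ _ (by norm_num)⟩, 1, one_pos, ?_⟩
    rw [hadd]
  · exact hbdd a b ha h fun u hu h1 h2 => ⟨hu, hsb _ _ h1, hsb _ _ h2⟩
  · exact hbdd a b ha h fun u hu h1 h2 => ⟨hu, hsb _ _ h1, h2⟩
  · exact hbdd a b ha h fun u hu h1 h2 => ⟨hu, h1, hsb _ _ h2⟩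
  · exact hbdd a b ha h fun u hu h1 h2 => ⟨hu, h1, h2⟩

/-- Any two points of an operator interval lie in a closed subinterval `[l, u]` of it whose
length `u - l` is bounded below by a positive scalar. -/
theorem IsOperatorInterval.exists_wide_Icc {I : Set A} (hI : IsOperatorInterval I) {a b : A}
    (ha : a ∈ I) (hb : b ∈ I) : ∃ l ∈ I, ∃ u ∈ I, l ≤ a ∧ l ≤ b ∧ a ≤ u ∧ b ≤ u ∧
      ∃ r : ℝ, 0 < r ∧ r • 1 ≤ u - l := by
  obtain ⟨v, hv, w, hw, r, hr, hvw⟩ := hI.exists_gap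
  obtain ⟨l₀, hl₀, hl₀a, hl₀b⟩ := hI.exists_le_le ha hb
  obtain ⟨l, hl, hll₀, hlv⟩ := hI.exists_le_le hl₀ hv
  obtain ⟨u₀, hu₀, hau₀, hbu₀⟩ := hI.exists_ge_ge ha hb
  obtain ⟨u, hu, hu₀u, hwu⟩ := hI.exists_ge_ge hu₀ hw
  refine ⟨l, hl, u, hu, hll₀.trans hl₀a, hll₀.trans hl₀b, hau₀.trans hu₀u, hbu₀.trans hu₀u, r, hr,
    ?_⟩
  rw [le_sub_iff_add_le']
  exact (add_le_add_left hlv _).trans (hvw.trans hwu)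

end Rays

/-! ### Projections below a positive element -/

section AWStar

variable {A : Type*} [CStarAlgebra A]

/-- The right annihilator of the negative part of `k` gives a projection splitting off the
positive part, a substitute for the spectral projection of `k` on `(0, ∞)`. -/
theorem exists_isStarProjection_mul_eq_posPart [IsAWStarAlgebra A] (k : A)
    (hk : IsSelfAdjoint k) : ∃ q : A, IsStarProjection q ∧ q * k = k⁺ ∧ k * q = k⁺ := by
  obtain ⟨q, hq, hann⟩ := IsAWStarAlgebra.exists_annihilator {k⁻} ⟨_, rfl⟩
  have h1 : q * k⁺ = k⁺ := by
    have h : k⁺ ∈ {x : A | ∃ a : A, x = q * a} := by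
      rw [← hann]
      rintro b rfl
      exact CFC.negPart_mul_posPart k
    obtain ⟨a, ha⟩ := h
    rw [ha, ← mul_assoc, hq.isIdempotentElem]
  have h2 : k⁻ * q = 0 := by
    have h : q ∈ {x : A | ∃ a : A, x = q * a} := ⟨1, (mul_one q).symm⟩
    rw [← hann] at h
    exact h _ rfl
  have hs := hq.isSelfAdjoint.star_eq
  -- the order only serves to see that `k⁺` and `k⁻` are self-adjoint
  let _ := CStarAlgebra.spectralOrder A
  have := CStarAlgebra.spectralOrderedRing A
  have h3 : k⁺ * q = k⁺ := by
    have h := congrArg star h1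
    rwa [star_mul, hs, (CFC.posPart_nonneg k).isSelfAdjoint.star_eq] at h
  have h4 : q * k⁻ = 0 := by
    have h := congrArg star h2
    rwa [star_mul, hs, (CFC.negPart_nonneg k).isSelfAdjoint.star_eq, star_zero] at h
  refine ⟨q, hq, ?_, ?_⟩
  · rw [← CFC.posPart_sub_negPart k hk]
    conv_lhs => rw [mul_sub, h1, h4, sub_zero]
    rw [CFC.posPart_sub_negPart k hk]
  · rw [← CFC.posPart_sub_negPart k hk]
    conv_lhs => rw [sub_mul, h3, h2, sub_zero]
    rw [CFC.posPart_sub_negPart k hk]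

variable [PartialOrder A]

theorem IsTypeIPart.isAbelianProjection {p : A} (hp : IsTypeIPart 1 p) :
    IsAbelianProjection p := by
  rcases hp.2.1 with rfl | h
  · exact ⟨hp.1.1, fun f _ _ x => by simp⟩
  · exact (isTypeI_one_iff.1 h).2.2

variable [StarOrderedRing A]

theorem exists_isStarProjection_smul_le [IsAWStarAlgebra A] {y : A} (hy : 0 ≤ y) (hy0 : y ≠ 0) :
    ∃ q : A, IsStarProjection q ∧ q ≠ 0 ∧ ∃ ε : ℝ, 0 < ε ∧ ε • q ≤ y := by
  have hn : 0 < ‖y‖ := norm_pos_iff.2 hy0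
  have hk : IsSelfAdjoint (y - (‖y‖ / 2) • 1) :=
    hy.isSelfAdjoint.sub (isSelfAdjoint_real_smul_one _)
  obtain ⟨q, hq, h1, h2⟩ := exists_isStarProjection_mul_eq_posPart _ hk
  refine ⟨q, hq, ?_, ‖y‖ / 2, by positivity, ?_⟩
  · rintro rfl
    rw [zero_mul, eq_comm, CFC.posPart_eq_zero_iff _ hk, sub_nonpos,
      ← Algebra.algebraMap_eq_smul_one,
      ← CStarAlgebra.norm_le_iff_le_algebraMap y (by positivity) hy] at h1
    linarith
  · have hqy : q * y = y * q := by
      have h := h1.trans h2.symm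
      simpa [mul_sub, sub_mul] using h
    have h3 : 0 ≤ (1 - q) * y * (1 - q) :=
      hq.one_sub.isSelfAdjoint.conjugate_nonneg hy
    have h4 : (1 - q) * y * (1 - q) = y - q * y := by
      have hqq : q * q = q := hq.isIdempotentElem
      have : q * y * q = q * y := by rw [hqy, mul_assoc, hqq]
      rw [mul_sub, mul_one, sub_mul, one_mul, sub_mul, this, ← hqy]
      abel
    have h5 : 0 ≤ q * (y - (‖y‖ / 2) • 1) := by
      rw [h1]
      exact CFC.posPart_nonneg _
    rw [mul_sub, mul_smul_comm, mul_one] at h5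
    rw [h4] at h3
    have h6 := add_nonneg h3 h5
    rw [← sub_nonneg]
    convert h6 using 1
    abel

theorem IsTypeIPart.exists_noncentral_smul_le [IsAWStarAlgebra A] {p y : A}
    (hp : IsTypeIPart 1 p) (hy : 0 ≤ y) (hpy : (1 - p) * y ≠ 0) :
    ∃ e : A, IsStarProjection e ∧ ¬ IsCentralProjection e ∧ ∃ ε : ℝ, 0 < ε ∧ ε • e ≤ y := by
  have hc := hp.1.one_sub
  obtain ⟨q, hq, hq0, ε, hε, hqy⟩ := exists_isStarProjection_smul_le (hc.mul_nonneg hy) hpy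
  have hpq : p * q = 0 := by
    have h1 := hp.1.mul_le_mul hqy
    rw [← mul_assoc, hp.1.mul_one_sub, zero_mul, mul_smul_comm] at h1
    have h2 : ε • (p * q) = 0 :=
      le_antisymm h1 (smul_nonneg hε.le (hp.1.mul_nonneg hq.nonneg))
    exact (smul_eq_zero.1 h2).resolve_left hε.ne'
  have hqp : q ≤ 1 - p := by
    rw [hq.le_iff_mul_eq_left hc.1, mul_sub, mul_one, ← hp.1.2, hpq, sub_zero]
  have hyy : (1 - p) * y ≤ y := by
    have h1 := hp.1.mul_nonneg hy
    rw [sub_mul, one_mul]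
    exact sub_le_self _ h1
  by_cases hqc : IsCentralProjection q
  · have hna : ¬ IsAbelianProjection q := fun ha =>
      hp.2.2 q (isTypeI_one_iff.2 ⟨hqc, hq0, ha⟩) hqp
    simp only [IsAbelianProjection, not_and, not_forall] at hna
    obtain ⟨f, hf, hfq, x, hx⟩ := hna hq
    exact ⟨f, hf, fun hfc => hx (hfc.2 _), ε, hε,
      (smul_le_smul_of_nonneg_left hfq hε.le).trans (hqy.trans hyy)⟩
  · exact ⟨q, hq, hqc, ε, hε, hqy.trans hyy⟩

theorem IsAbelianProjection.isCentralProjection_of_le {p f : A} (ha : IsAbelianProjection p)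
    (hp : IsCentralProjection p) (hf : IsStarProjection f) (hfp : f ≤ p) :
    IsCentralProjection f := by
  have h1 : f * p = f := (hf.le_iff_mul_eq_left hp.1).1 hfp
  have h2 : p * f = f := by rw [hp.2, h1]
  refine ⟨hf, fun x => ?_⟩
  have h := ha.2 f hf hfp x
  rw [← mul_assoc, ← mul_assoc, h1, mul_assoc (p * x), h2, mul_assoc f, ← hp.2, ← mul_assoc, h1,
    hp.2, mul_assoc, h2] at h
  exact h

end AWStar

/-! ### Existence and non-existence of suprema -/

section Suprema

variable {A : Type*} [CStarAlgebra A]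

theorem IsStarProjection.exists_offDiagonal {e : A} (he : IsStarProjection e)
    (hc : ¬ IsCentralProjection e) : ∃ v : A, e * v = v ∧ v * e = 0 ∧ ‖v‖ = 5 / 4 := by
  have hee : e * e = e := he.isIdempotentElem
  have h : ∃ v : A, e * v = v ∧ v * e = 0 ∧ v ≠ 0 := by
    by_contra! hcon
    have key : ∀ x, e * x = e * x * e := fun x => by
      have h0 := hcon (e * x - e * x * e) (by simp only [mul_sub, ← mul_assoc, hee])
        (by simp only [sub_mul, mul_assoc, hee, sub_self])
      exact sub_eq_zero.1 h0
    refine hc ⟨he, fun x => ?_⟩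
    have h1 := congrArg star (key (star x))
    simp only [star_mul, star_star, he.isSelfAdjoint.star_eq] at h1
    rw [h1, key x, mul_assoc]
  obtain ⟨v, h1, h2, h3⟩ := h
  have h4 : ‖v‖ ≠ 0 := norm_ne_zero_iff.2 h3
  refine ⟨(5 / 4 / ‖v‖) • v, by rw [mul_smul_comm, h1], by rw [smul_mul_assoc, h2, smul_zero], ?_⟩
  rw [norm_smul, Real.norm_of_nonneg (by positivity)]
  field_simp

variable [PartialOrder A] [StarOrderedRing A]

/-- If `p A` is commutative and `s` differs from some `a ≤ c` only in that summand, then `s` and `c`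
have a supremum, namely `c` plus the positive part of `p (s - c)`. -/
theorem IsAbelianProjection.exists_sup [IsAWStarAlgebra A] {p a s c : A}
    (hpa : IsAbelianProjection p) (hp : IsCentralProjection p) (hs : IsSelfAdjoint s)
    (hc : IsSelfAdjoint c) (hac : a ≤ c) (hsa : (1 - p) * s = (1 - p) * a) :
    ∃ m, s ≤ m ∧ c ≤ m ∧ ∀ h, s ≤ h → c ≤ h → m ≤ h := by
  have hk : IsSelfAdjoint (p * (s - c)) := hp.isSelfAdjoint_mul (hs.sub hc)
  obtain ⟨q, hq, hqk, hkq⟩ := exists_isStarProjection_mul_eq_posPart _ hk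
  have hf : IsStarProjection (p * q) := by
    refine ⟨?_, ?_⟩
    · change p * q * (p * q) = p * q
      rw [mul_assoc, ← mul_assoc q, ← hp.2 q, mul_assoc, ← mul_assoc p, hp.mul_self,
        hq.isIdempotentElem]
    · change star (p * q) = p * q
      rw [star_mul, hq.isSelfAdjoint.star_eq, hp.1.isSelfAdjoint.star_eq, hp.2]
  have hfp : p * q ≤ p := by
    rw [hf.le_iff_mul_eq_left hp.1, mul_assoc, ← hp.2 q, ← mul_assoc, hp.mul_self]
  have hfc := hpa.isCentralProjection_of_le hp hf hfp
  have hfk : p * q * (s - c) = (p * (s - c))⁺ := by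
    rw [← hqk, ← mul_assoc, hp.2 q]
  refine ⟨c + (p * (s - c))⁺, ?_, le_add_of_nonneg_right (CFC.posPart_nonneg _),
    fun h hsh hch => ?_⟩
  · have h1 := add_nonneg (hp.one_sub.mul_nonneg (sub_nonneg.2 hac))
      (CFC.negPart_nonneg (p * (s - c)))
    have h2 : (p * (s - c))⁻ = (p * (s - c))⁺ - p * (s - c) := by
      rw [eq_sub_iff_add_eq, add_comm, ← eq_sub_iff_add_eq, CFC.posPart_sub_negPart _ hk]
    rw [h2, mul_sub, ← hsa] at h1
    rw [← sub_nonneg]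
    convert h1 using 1
    simp only [sub_mul, mul_sub, one_mul]
    abel
  · have h1 := add_nonneg (hfc.mul_nonneg (sub_nonneg.2 hsh))
      (hfc.one_sub.mul_nonneg (sub_nonneg.2 hch))
    rw [← hfk, ← sub_nonneg]
    convert h1 using 1
    simp only [sub_mul, mul_sub, one_mul]
    abel

theorem mul_eq_zero_of_conjugate_nonpos {u e : A} (hu : 0 ≤ u) (he : IsSelfAdjoint e)
    (h : e * u * e ≤ 0) : u * e = 0 := by
  obtain ⟨r, rfl⟩ := CStarAlgebra.nonneg_iff_eq_star_mul_self.1 hu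
  have h1 : star (r * e) * (r * e) = e * (star r * r) * e := by
    rw [star_mul, he.star_eq]
    simp only [mul_assoc]
  have h2 : star (r * e) * (r * e) = 0 := by
    refine le_antisymm (h1.le.trans h) (star_mul_self_nonneg _)
  rw [CStarRing.star_mul_self_eq_zero_iff] at h2
  rw [mul_assoc, h2, mul_zero]

/-- For a non-central projection `e`, the elements `δ e` and `δ (1 - e)` have no supremum, even
among the elements below some `d ≥ 5 δ`. A supremum would be `δ`, but with an off-diagonal `v` of
norm `5 / 4` also `δ (2 + v + star v)` is an upper bound, and it is not above `δ`. -/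
theorem IsStarProjection.not_exists_sup {e s d : A} (he : IsStarProjection e)
    (hc : ¬ IsCentralProjection e) {δ : ℝ} (hδ : 0 < δ) (hd : (5 * δ) • 1 ≤ d)
    (hes : δ • e ≤ s) (hfs : δ • (1 - e) ≤ s)
    (hs : ∀ h, δ • e ≤ h → δ • (1 - e) ≤ h → h ≤ d → s ≤ h) : False := by
  obtain ⟨v, hev, hve, hv⟩ := he.exists_offDiagonal hc
  have hee : e * e = e := he.isIdempotentElem
  have hse := he.isSelfAdjoint.star_eq
  have hve' : star v * e = star v := by
    have h := congrArg star hev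
    rwa [star_mul, hse] at h
  have hev' : e * star v = 0 := by
    have h := congrArg star hve
    rwa [star_mul, hse, star_zero] at h
  have hvv : v * v = 0 := by
    nth_rw 2 [← hev]
    rw [← mul_assoc, hve, zero_mul]
  have hvv' : star v * star v = 0 := by rw [← star_mul, hvv, star_zero]
  have hvf : v * (1 - e) = v := by rw [mul_sub, mul_one, hve, sub_zero]
  have hfv' : (1 - e) * star v = star v := by rw [sub_mul, one_mul, hev', sub_zero]
  -- the square of the norm of `v` lies between `1` and `2`
  have hle2 : star v * v ≤ (2 : ℝ) • (1 - e) := by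
    have h1 : star v * v ≤ (2 : ℝ) • 1 := by
      refine (CStarAlgebra.star_mul_le_algebraMap_norm_sq (a := v)).trans ?_
      rw [Algebra.algebraMap_eq_smul_one, hv]
      exact smul_one_le_smul_one (by norm_num)
    have h2 := he.one_sub.isSelfAdjoint.conjugate_nonneg (sub_nonneg.2 h1)
    have h3 : (1 - e) * ((2 : ℝ) • 1 - star v * v) * (1 - e) = (2 : ℝ) • (1 - e) - star v * v := by
      have hff : (1 - e) * (1 - e) = 1 - e := he.one_sub.isIdempotentElem
      rw [mul_sub (1 - e), sub_mul _ _ (1 - e), ← mul_assoc, hfv', mul_assoc (star v), hvf,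
        mul_smul_comm, mul_one, smul_mul_assoc, hff]
    rw [h3] at h2
    exact sub_nonneg.1 h2
  have hnle : ¬ star v * v ≤ 1 := by
    intro h
    have h1 := CStarAlgebra.norm_le_norm_of_nonneg_of_le (star_mul_self_nonneg v) h
    rw [CStarRing.norm_star_mul_self, hv] at h1
    rcases subsingleton_or_nontrivial A with hA | hA
    · rw [Subsingleton.elim v 0, norm_zero] at hv
      norm_num at hv
    · rw [CStarRing.norm_one] at h1
      norm_num at h1
  have hz : (0 : A) ≤ 1 := zero_le_one
  have hs1 : s ≤ δ • 1 := by
    refine hs _ ?_ ?_ (le_trans (smul_one_le_smul_one (by linarith)) hd)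
    · exact smul_le_smul_of_nonneg_left he.le_one hδ.le
    · exact smul_le_smul_of_nonneg_left he.one_sub.le_one hδ.le
  have hs2 : δ • (1 : A) = s := by
    have hu : 0 ≤ δ • 1 - s := sub_nonneg.2 hs1
    have hff : e * (1 - e) = 0 := by rw [mul_sub, mul_one, hee, sub_self]
    have hff' : (1 - e) * e = 0 := by rw [sub_mul, one_mul, hee, sub_self]
    have hu1 : (δ • 1 - s) * e = 0 := by
      refine mul_eq_zero_of_conjugate_nonpos hu he.isSelfAdjoint ?_
      have h1 : δ • 1 - s ≤ δ • (1 - e) := by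
        rw [smul_sub]
        exact sub_le_sub_left hes _
      have h2 := he.isSelfAdjoint.conjugate_le_conjugate h1
      rwa [mul_smul_comm, hff, smul_zero, zero_mul] at h2
    have hu2 : (δ • 1 - s) * (1 - e) = 0 := by
      refine mul_eq_zero_of_conjugate_nonpos hu he.one_sub.isSelfAdjoint ?_
      have h1 : δ • 1 - s ≤ δ • e := by
        rw [smul_sub] at hfs
        exact sub_le_comm.1 hfs
      have h2 := he.one_sub.isSelfAdjoint.conjugate_le_conjugate h1
      rwa [mul_smul_comm, hff', smul_zero, zero_mul] at h2
    have h := congrArg₂ (· + ·) hu1 hu2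
    simp only [← mul_add, add_sub_cancel, mul_one, add_zero] at h
    exact sub_eq_zero.1 h
  have hh : s ≤ δ • ((2 : ℝ) • 1 + v + star v) := by
    refine hs _ ?_ ?_ ?_
    · refine smul_le_smul_of_nonneg_left ?_ hδ.le
      have h1 := add_nonneg (star_mul_self_nonneg (e + v)) (sub_nonneg.2 hle2)
      rw [← sub_nonneg]
      convert h1 using 1
      simp only [star_add, hse, add_mul, mul_add, hee, hev, hve', smul_sub, two_smul]
      abel
    · refine smul_le_smul_of_nonneg_left ?_ hδ.le
      have h1 := add_nonneg (star_mul_self_nonneg ((2 : ℝ) • e + v)) (sub_nonneg.2 hle2)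
      have h2 : star ((2 : ℝ) • e + v) * ((2 : ℝ) • e + v) + ((2 : ℝ) • (1 - e) - star v * v)
          = (2 : ℝ) • ((2 : ℝ) • 1 + v + star v - (1 - e)) := by
        simp only [star_add, hse, add_mul, mul_add, hee, hev, hve', smul_sub, two_smul]
        abel
      rw [h2] at h1
      have h3 := smul_nonneg (show (0 : ℝ) ≤ 1 / 2 by norm_num) h1
      rw [smul_smul, one_div, inv_mul_cancel₀ two_ne_zero, one_smul] at h3
      exact sub_nonneg.1 h3
    · refine le_trans ?_ hd
      rw [mul_comm, mul_smul]
      refine smul_le_smul_of_nonneg_left ?_ hδ.le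
      have h1 : v + star v ≤ (3 : ℝ) • 1 := by
        refine (IsSelfAdjoint.add_star_self v).le_algebraMap_norm_self.trans ?_
        rw [Algebra.algebraMap_eq_smul_one]
        refine smul_one_le_smul_one ((norm_add_le _ _).trans ?_)
        rw [norm_star, hv]
        norm_num
      calc (2 : ℝ) • 1 + v + star v = (2 : ℝ) • 1 + (v + star v) := add_assoc _ _ _
        _ ≤ (2 : ℝ) • 1 + (3 : ℝ) • 1 := add_le_add_right h1 _
        _ = (5 : ℝ) • 1 := by rw [← add_smul]; norm_num
  rw [← hs2] at hh
  have h1 : (0 : A) ≤ 1 + v + star v := by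
    have h2 := smul_le_smul_of_nonneg_left hh (inv_nonneg.2 hδ.le)
    rw [smul_smul, smul_smul, inv_mul_cancel₀ hδ.ne', one_smul, one_smul, ← sub_nonneg] at h2
    convert h2 using 1
    rw [two_smul]
    abel
  have h2 := star_left_conjugate_nonneg h1 (v - (1 - e))
  have h3 : star (v - (1 - e)) * (1 + v + star v) * (v - (1 - e)) = (1 - e) - star v * v := by
    have h4 : (1 + v + star v) * (v - (1 - e)) = star v * v - (1 - e) := by
      simp only [mul_sub, add_mul, mul_one, one_mul, hvv, hve, hve']
      abel
    have h5 : e * (star v * v) = 0 := by rw [← mul_assoc, hev', zero_mul]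
    have h6 : star v * (star v * v) = 0 := by rw [← mul_assoc, hvv', zero_mul]
    rw [mul_assoc, h4]
    simp only [star_sub, star_one, hse, sub_mul, mul_sub, mul_one, one_mul, h5, h6, hve', hee]
    abel
  rw [h3, sub_nonneg] at h2
  exact hnle (h2.trans he.one_sub.le_one)

end Suprema

/-! ### Order isomorphisms respect the type `I₁` decomposition -/

section OrderIso

variable {A : Type*} [CStarAlgebra A] [PartialOrder A] [StarOrderedRing A]
variable {B : Type*} [CStarAlgebra B] [PartialOrder B] [StarOrderedRing B]

/-- If the closed interval `[Φ l, Φ u]` is wide, then `Φ` sends `z = p u + (1 - p) l`, the largest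
element of `[l, u]` that differs from `l` only in `p A`, to an element that differs from `Φ l` only
in the type `I₁` summand. Otherwise a multiple of a non-central projection would lie below
`Φ z - Φ l` and yield two elements of `[Φ l, Φ u]` without supremum, while their preimages have
one. -/
theorem OrderIso.one_sub_mul_apply_glue [IsAWStarAlgebra A] [IsAWStarAlgebra B]
    {I : Set A} {J : Set B} (hI : IsOperatorInterval I) (hJ : IsOperatorInterval J)
    (Φ : I ≃o J) {p : A} {q : B} (hp : IsTypeIPart 1 p) (hq : IsTypeIPart 1 q) {l u : I}
    (hlu : l ≤ u) {r : ℝ} (hr : 0 < r) (hw : r • (1 : B) ≤ Φ u - Φ l) {z : I}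
    (hz : (z : A) = glue p (u : A) l) : (1 - q) * (Φ z : B) = (1 - q) * (Φ l : B) := by
  have hlz : l ≤ z := by
    rw [← Subtype.coe_le_coe, hz]
    exact (glue_self p (l : A)).ge.trans (hp.1.glue_le_glue hlu le_rfl)
  have hzu : z ≤ u := by
    rw [← Subtype.coe_le_coe, hz]
    exact (hp.1.glue_le_glue le_rfl hlu).trans (glue_self _ _).le
  have hlz' : (Φ l : B) ≤ Φ z := Φ.monotone hlz
  have hzu' : (Φ z : B) ≤ Φ u := Φ.monotone hzu
  by_contra hne
  obtain ⟨e, he, hec, ε, hε, hle⟩ := hq.exists_noncentral_smul_le (sub_nonneg.2 hlz')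
    (by rwa [mul_sub, Ne, sub_eq_zero])
  set δ := min ε (r / 5)
  have hδ : 0 < δ := lt_min hε (by positivity)
  have hδr : 5 * δ ≤ r := by
    have := min_le_right ε (r / 5)
    linarith
  have hd : (5 * δ) • (1 : B) ≤ Φ u - Φ l := (smul_one_le_smul_one hδr).trans hw
  have hmem : ∀ h : B, 0 ≤ h → h ≤ Φ u - Φ l → (Φ l : B) + h ∈ J := fun h h1 h2 =>
    hJ.mem_of_le_of_le (Φ l).2 (Φ u).2 (le_add_of_nonneg_right h1) (by rwa [← le_sub_iff_add_le'])
  have hez : δ • e ≤ Φ z - Φ l :=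
    (smul_le_smul_of_nonneg_right (min_le_left _ _) he.nonneg).trans hle
  have hs0 : (0 : B) ≤ δ • e := smul_nonneg hδ.le he.nonneg
  have hc0 : (0 : B) ≤ δ • (1 - e) := smul_nonneg hδ.le he.one_sub.nonneg
  have hcu : δ • (1 - e) ≤ Φ u - Φ l :=
    (smul_le_smul_of_nonneg_left he.one_sub.le_one hδ.le).trans
      ((smul_one_le_smul_one (by linarith)).trans hd)
  let s' : J := ⟨_, hmem _ hs0 (hez.trans (sub_le_sub_right hzu' _))⟩
  let c' : J := ⟨_, hmem _ hc0 hcu⟩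
  have hls : l ≤ Φ.symm s' := (Φ.le_symm_apply).2 (le_add_of_nonneg_right hs0 : (Φ l : B) ≤ _)
  have hlc : l ≤ Φ.symm c' := (Φ.le_symm_apply).2 (le_add_of_nonneg_right hc0 : (Φ l : B) ≤ _)
  have hsz : Φ.symm s' ≤ z :=
    (Φ.symm_apply_le).2 (le_sub_iff_add_le'.1 hez : (Φ l : B) + _ ≤ Φ z)
  have hcu' : Φ.symm c' ≤ u :=
    (Φ.symm_apply_le).2 (le_sub_iff_add_le'.1 hcu : (Φ l : B) + _ ≤ Φ u)
  have hsl : (1 - p) * (Φ.symm s' : A) = (1 - p) * (l : A) := by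
    refine le_antisymm ?_ (hp.1.one_sub.mul_le_mul hls)
    have h := hp.1.one_sub.mul_le_mul (Subtype.coe_le_coe.2 hsz)
    rwa [hz, hp.1.one_sub_mul_glue] at h
  obtain ⟨m, hsm, hcm, hm⟩ := hp.isAbelianProjection.exists_sup hp.1
    (hI.isSelfAdjoint (Φ.symm s').2) (hI.isSelfAdjoint (Φ.symm c').2) hlc hsl
  have hmI : m ∈ I := hI.mem_of_le_of_le l.2 u.2 (le_trans hls hsm)
    (hm u (Subtype.coe_le_coe.2 (hsz.trans hzu)) hcu')
  have hsm' : s' ≤ Φ ⟨m, hmI⟩ := (Φ.symm_apply_le).1 hsm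
  have hcm' : c' ≤ Φ ⟨m, hmI⟩ := (Φ.symm_apply_le).1 hcm
  refine he.not_exists_sup hec hδ hd (s := (Φ ⟨m, hmI⟩ : B) - Φ l) (le_sub_iff_add_le'.2 hsm')
    (le_sub_iff_add_le'.2 hcm') fun h h1 h2 h3 => ?_
  let h' : J := ⟨_, hmem h (hs0.trans h1) h3⟩
  have hsh : s' ≤ h' := add_le_add_right h1 (Φ l : B)
  have hch : c' ≤ h' := add_le_add_right h2 (Φ l : B)
  have hmh : (⟨m, hmI⟩ : I) ≤ Φ.symm h' :=
    hm _ (Φ.symm.monotone hsh) (Φ.symm.monotone hch)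
  exact sub_le_iff_le_add'.2 ((Φ.le_symm_apply).1 hmh : (Φ ⟨m, hmI⟩ : B) ≤ _)

theorem OrderIso.one_sub_mul_apply_eq_of_le [IsAWStarAlgebra A] [IsAWStarAlgebra B]
    {I : Set A} {J : Set B} (hI : IsOperatorInterval I) (hJ : IsOperatorInterval J)
    (Φ : I ≃o J) {p : A} {q : B} (hp : IsTypeIPart 1 p) (hq : IsTypeIPart 1 q) {a b : I}
    (hle : a ≤ b) (hab : (1 - p) * (a : A) = (1 - p) * (b : A)) :
    (1 - q) * (Φ a : B) = (1 - q) * (Φ b : B) := by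
  obtain ⟨l', hl', u', hu', hla, -, -, hbu, r, hr, hw⟩ := hJ.exists_wide_Icc (Φ a).2 (Φ b).2
  obtain ⟨l, hl⟩ := Φ.surjective ⟨l', hl'⟩
  obtain ⟨u, hu⟩ := Φ.surjective ⟨u', hu'⟩
  replace hl : (Φ l : B) = l' := congrArg Subtype.val hl
  replace hu : (Φ u : B) = u' := congrArg Subtype.val hu
  rw [← hl] at hla hw
  rw [← hu] at hbu hw
  have hla₀ : l ≤ a := Φ.le_iff_le.1 hla
  have hbu₀ : b ≤ u := Φ.le_iff_le.1 hbu
  have hlb₀ : l ≤ b := hla₀.trans hle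
  let z : I := ⟨_, hI.glue_mem hp.1 u.2 l.2⟩
  -- `b` is the supremum of `a` and `w`, where `w ≤ z`
  let w : I := ⟨_, hI.glue_mem hp.1 b.2 l.2⟩
  have hz := Φ.one_sub_mul_apply_glue hI hJ hp hq (hlb₀.trans hbu₀) hr hw (z := z) rfl
  have hwz : w ≤ z := hp.1.glue_le_glue hbu₀ le_rfl
  have hwb : w ≤ b := (hp.1.glue_le_glue (le_refl (b : A)) hlb₀).trans (glue_self _ _).le
  have hwa : (1 - q) * (Φ w : B) ≤ (1 - q) * (Φ a : B) := by
    refine (hq.1.one_sub.mul_le_mul (Φ.monotone hwz : (Φ w : B) ≤ _)).trans ?_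
    rw [hz]
    exact hq.1.one_sub.mul_le_mul hla
  let g : J := ⟨_, hJ.glue_mem hq.1 (Φ b).2 (Φ a).2⟩
  have hag : a ≤ Φ.symm g := by
    refine (Φ.le_symm_apply).2 (le_of_mul_le_mul_of_one_sub_mul_le (p := q) ?_ ?_)
    · exact (hq.1.mul_le_mul (Φ.monotone hle : (Φ a : B) ≤ _)).trans (hq.1.mul_glue _ _).ge
    · exact (hq.1.one_sub_mul_glue _ _).ge
  have hwg : w ≤ Φ.symm g := by
    refine (Φ.le_symm_apply).2 (le_of_mul_le_mul_of_one_sub_mul_le (p := q) ?_ ?_)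
    · exact (hq.1.mul_le_mul (Φ.monotone hwb : (Φ w : B) ≤ _)).trans (hq.1.mul_glue _ _).ge
    · exact hwa.trans (hq.1.one_sub_mul_glue _ _).ge
  have hbg : b ≤ Φ.symm g := by
    refine le_of_mul_le_mul_of_one_sub_mul_le (p := p) ?_ ?_
    · exact (hp.1.mul_glue (b : A) l).ge.trans (hp.1.mul_le_mul hwg)
    · rw [← hab]
      exact hp.1.one_sub.mul_le_mul hag
  refine le_antisymm (hq.1.one_sub.mul_le_mul (Φ.monotone hle : (Φ a : B) ≤ _)) ?_
  have h := hq.1.one_sub.mul_le_mul ((Φ.le_symm_apply).1 hbg : (Φ b : B) ≤ g)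
  exact h.trans (hq.1.one_sub_mul_glue _ _).le

theorem OrderIso.one_sub_mul_apply_le [IsAWStarAlgebra A] [IsAWStarAlgebra B]
    {I : Set A} {J : Set B} (hI : IsOperatorInterval I) (hJ : IsOperatorInterval J)
    (Φ : I ≃o J) {p : A} {q : B} (hp : IsTypeIPart 1 p) (hq : IsTypeIPart 1 q) (a b : I)
    (hab : (1 - p) * (a : A) ≤ (1 - p) * (b : A)) :
    (1 - q) * (Φ a : B) ≤ (1 - q) * (Φ b : B) := by
  obtain ⟨d, hd, had, hbd⟩ := hI.exists_ge_ge a.2 b.2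
  let a₁ : I := ⟨_, hI.glue_mem hp.1 hd a.2⟩
  let b₁ : I := ⟨_, hI.glue_mem hp.1 hd b.2⟩
  have haa : a ≤ a₁ := (glue_self p (a : A)).ge.trans (hp.1.glue_le_glue had le_rfl)
  have hbb : b ≤ b₁ := (glue_self p (b : A)).ge.trans (hp.1.glue_le_glue hbd le_rfl)
  have hab₁ : a₁ ≤ b₁ := add_le_add le_rfl hab
  rw [Φ.one_sub_mul_apply_eq_of_le hI hJ hp hq haa (hp.1.one_sub_mul_glue _ _).symm,
    Φ.one_sub_mul_apply_eq_of_le hI hJ hp hq hbb (hp.1.one_sub_mul_glue _ _).symm]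
  exact hq.1.one_sub.mul_le_mul (Φ.monotone hab₁ : (Φ a₁ : B) ≤ _)

/-- That `Φ` and its inverse respect the second components already forces `Φ` to respect the first
ones: if `a ≤ b` have the same first component, then the preimage of `q Φ(a) + (1 - q) Φ(b)` lies
between them, so it has that first component too; its second component is that of `b`, so it
is `b`. -/
theorem OrderIso.mul_apply_eq_of_le [IsAWStarAlgebra A] [IsAWStarAlgebra B]
    {I : Set A} {J : Set B} (hI : IsOperatorInterval I) (hJ : IsOperatorInterval J)
    (Φ : I ≃o J) {p : A} {q : B} (hp : IsTypeIPart 1 p) (hq : IsTypeIPart 1 q) {a b : I}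
    (hle : a ≤ b) (hab : p * (a : A) = p * (b : A)) :
    q * (Φ a : B) = q * (Φ b : B) := by
  have hle' : (Φ a : B) ≤ Φ b := Φ.monotone hle
  let g : J := ⟨_, hJ.glue_mem hq.1 (Φ a).2 (Φ b).2⟩
  have hag : a ≤ Φ.symm g := (Φ.le_symm_apply).2
    ((glue_self q (Φ a : B)).ge.trans (hq.1.glue_le_glue le_rfl hle'))
  have hgb : (1 - p) * (b : A) ≤ (1 - p) * (Φ.symm g : A) := by
    have h := Φ.symm.one_sub_mul_apply_le hJ hI hq hp (Φ b) g (hq.1.one_sub_mul_glue _ _).ge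
    rwa [Φ.symm_apply_apply] at h
  have hbg : b ≤ Φ.symm g := le_of_mul_le_mul_of_one_sub_mul_le (p := p)
    (hab.ge.trans (hp.1.mul_le_mul hag)) hgb
  refine le_antisymm (hq.1.mul_le_mul hle') ?_
  exact (hq.1.mul_le_mul ((Φ.le_symm_apply).1 hbg : (Φ b : B) ≤ g)).trans (hq.1.mul_glue _ _).le

theorem OrderIso.mul_apply_le [IsAWStarAlgebra A] [IsAWStarAlgebra B]
    {I : Set A} {J : Set B} (hI : IsOperatorInterval I) (hJ : IsOperatorInterval J)
    (Φ : I ≃o J) {p : A} {q : B} (hp : IsTypeIPart 1 p) (hq : IsTypeIPart 1 q) (a b : I)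
    (hab : p * (a : A) ≤ p * (b : A)) : q * (Φ a : B) ≤ q * (Φ b : B) := by
  obtain ⟨d, hd, had, hbd⟩ := hI.exists_ge_ge a.2 b.2
  let a₁ : I := ⟨_, hI.glue_mem hp.1 a.2 hd⟩
  let b₁ : I := ⟨_, hI.glue_mem hp.1 b.2 hd⟩
  have haa : a ≤ a₁ := (glue_self p (a : A)).ge.trans (hp.1.glue_le_glue le_rfl had)
  have hbb : b ≤ b₁ := (glue_self p (b : A)).ge.trans (hp.1.glue_le_glue le_rfl hbd)
  have hab₁ : a₁ ≤ b₁ := add_le_add hab le_rfl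
  rw [Φ.mul_apply_eq_of_le hI hJ hp hq haa (hp.1.mul_glue _ _).symm,
    Φ.mul_apply_eq_of_le hI hJ hp hq hbb (hp.1.mul_glue _ _).symm]
  exact hq.1.mul_le_mul (Φ.monotone hab₁ : (Φ a₁ : B) ≤ _)

end OrderIso

/-! ### Order isomorphisms between the cuts -/

section LeftCut

theorem leftCut.mk_surjective {A : Type*} [Mul A] (p : A) (I : Set A) :
    Function.Surjective (leftCut.mk p : I → leftCut p I) := by
  rintro ⟨_, a, ha, rfl⟩
  exact ⟨⟨a, ha⟩, rfl⟩

theorem leftCut.exists_orderIso {A B : Type*} [Mul A] [PartialOrder A] [Mul B] [PartialOrder B]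
    {I : Set A} {J : Set B} (Φ : I ≃o J) (p : A) (q : B)
    (h₁ : ∀ a b : I, p * (a : A) ≤ p * (b : A) → q * (Φ a : B) ≤ q * (Φ b : B))
    (h₂ : ∀ a b : J, q * (a : B) ≤ q * (b : B) → p * (Φ.symm a : A) ≤ p * (Φ.symm b : A)) :
    ∃ Ψ : leftCut p I ≃o leftCut q J, ∀ a, Ψ (leftCut.mk p a) = leftCut.mk q (Φ a) := by
  have hsp := Function.surjInv_eq (leftCut.mk_surjective p I)
  have hle : ∀ a b : I, leftCut.mk p a ≤ leftCut.mk p b ↔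
      leftCut.mk q (Φ a) ≤ leftCut.mk q (Φ b) := fun a b =>
    ⟨h₁ a b, fun h => by
      have h0 := h₂ (Φ a) (Φ b) h
      rwa [Φ.symm_apply_apply, Φ.symm_apply_apply] at h0⟩
  let f : leftCut p I → leftCut q J := fun x =>
    leftCut.mk q (Φ (Function.surjInv (leftCut.mk_surjective p I) x))
  have hf : ∀ a, f (leftCut.mk p a) = leftCut.mk q (Φ a) := fun a =>
    le_antisymm ((hle _ _).1 (hsp _).le) ((hle _ _).1 (hsp _).ge)
  have hmono : ∀ x y, f x ≤ f y ↔ x ≤ y := by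
    intro x y
    obtain ⟨a, rfl⟩ := leftCut.mk_surjective p I x
    obtain ⟨b, rfl⟩ := leftCut.mk_surjective p I y
    rw [hf, hf, hle]
  have hsurj : Function.Surjective f := by
    intro y
    obtain ⟨b, rfl⟩ := leftCut.mk_surjective q J y
    exact ⟨leftCut.mk p (Φ.symm b), by rw [hf, Φ.apply_symm_apply]⟩
  exact ⟨RelIso.ofSurjective (OrderEmbedding.ofMapLEIff f hmono) hsurj, hf⟩

end LeftCut

theorem mainTheorem10
    {A : Type*} [CStarAlgebra A] [PartialOrder A] [StarOrderedRing A] [IsAWStarAlgebra A]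
    {B : Type*} [CStarAlgebra B] [PartialOrder B] [StarOrderedRing B] [IsAWStarAlgebra B]
    (I : Set A) (J : Set B) (hI : IsOperatorInterval I) (hJ : IsOperatorInterval J)
    (Φ : I ≃o J) :
    ∃! Ψ : (leftCut (typeIOnePart A) I ≃o leftCut (typeIOnePart B) J) ×
        (leftCut (1 - typeIOnePart A) I ≃o leftCut (1 - typeIOnePart B) J),
      ∀ a : I, (Φ a : B) =
        (Ψ.1 (leftCut.mk (typeIOnePart A) a) : B) +
          (Ψ.2 (leftCut.mk (1 - typeIOnePart A) a) : B) := by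
  have hp := isTypeIPart_typeIOnePart A
  have hq := isTypeIPart_typeIOnePart B
  obtain ⟨Ψ₁, hΨ₁⟩ := leftCut.exists_orderIso Φ (typeIOnePart A) (typeIOnePart B)
    (Φ.mul_apply_le hI hJ hp hq) (Φ.symm.mul_apply_le hJ hI hq hp)
  obtain ⟨Ψ₂, hΨ₂⟩ := leftCut.exists_orderIso Φ (1 - typeIOnePart A) (1 - typeIOnePart B)
    (Φ.one_sub_mul_apply_le hI hJ hp hq) (Φ.symm.one_sub_mul_apply_le hJ hI hq hp)
  refine ⟨(Ψ₁, Ψ₂), fun a => ?_, ?_⟩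
  · rw [hΨ₁, hΨ₂]
    exact (glue_self _ _).symm
  · rintro ⟨Θ₁, Θ₂⟩ hΘ
    -- multiplying the equation by either projection recovers the corresponding component
    have key : ∀ a : I, Θ₁ (leftCut.mk _ a) = leftCut.mk _ (Φ a) ∧
        Θ₂ (leftCut.mk _ a) = leftCut.mk _ (Φ a) := by
      intro a
      obtain ⟨b, hb⟩ := leftCut.mk_surjective _ J (Θ₁ (leftCut.mk _ a))
      obtain ⟨c, hc⟩ := leftCut.mk_surjective _ J (Θ₂ (leftCut.mk _ a))
      have h : (Φ a : B) = glue (typeIOnePart B) (b : B) c := by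
        have h0 := hΘ a
        rw [← hb, ← hc] at h0
        exact h0
      rw [← hb, ← hc]
      refine ⟨Subtype.ext ?_, Subtype.ext ?_⟩
      · change _ * (b : B) = _ * (Φ a : B)
        rw [h, hq.1.mul_glue]
      · change _ * (c : B) = _ * (Φ a : B)
        rw [h, hq.1.one_sub_mul_glue]
    refine Prod.ext (OrderIso.ext (funext fun x => ?_)) (OrderIso.ext (funext fun x => ?_))
    · obtain ⟨a, rfl⟩ := leftCut.mk_surjective _ I x
      exact (key a).1.trans (hΨ₁ a).symm
    · obtain ⟨a, rfl⟩ := leftCut.mk_surjective _ I x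
      exact (key a).2.trans (hΨ₂ a).symm
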